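/- Theorem. For every $n$ let $d=d(n)\ge 1$ be an integer and let $X(n)=(X_1,\dots,X_d)$ be a Gaussian random vector in $\mathbb{R}^d$ (its components and its law depend on $n$, and it may be defined on a probability space depending on $n$) with $\operatorname{Var}X_i>0$ for all $i\in[d]=\{1,\dots,d\}$. Let $(a_n)$, $(b_n)$ be sequences of real numbers and let $F:\mathbb{R}\to(0,\infty)$ be a function such that, as $n\to\infty$, $$\prod_{i=1}^{d}\mathbf{P}(X_i\le a_n+b_nx)\to F(x)\qquad\text{for every } x\in\mathbb{R}.$$ Put $r_{ij}=r_{ij}(n)=\dfrac{\operatorname{cov}(X_i,X_j)}{\sqrt{\operatorname{Var}X_i\operatorname{Var}X_j}}$, $\;u_i=u_i(n,x)=\dfrac{a_n+b_nx-\mathbf{E}X_i}{\sqrt{\operatorname{Var}X_i}}$ and $u_{\min}=u_{\min}(n,x)=\min_{i\in[d]}u_i$. Suppose that for every $x\in\mathbb{R}$ there are (possibly directed) graphs $\mathbf{D}=\mathbf{D}(n,x)$ on the vertex sets $[d(n)]$, $n\in\mathbb N$, with closed (out-)neighbourhoods $D_i\subseteq[d]$ ($i\in[d]$), such that, as $n\to\infty$,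 (G1) $\liminf_n u_{\min}(n,x)>1$; (G2) $\max_{i\in[d]}\max_{j\in[i-1]\setminus D_i}|r_{ij}|\,\log d\to0$; (G3) $\displaystyle\sum_{i\in[d]}\sum_{j\in[i-1]\cap D_i}\exp\Big(-\frac{u_i^2+u_j^2}{2(1+|r_{ij}|)}\Big)\to0$; (G4) $\limsup_n\max_{i\ne j}|r_{ij}|<\rho$ for some fixed $\rho\in(0,1)$. (A maximum over an empty set of pairs in (G2) or (G4) imposes no condition: it counts as $0$. The value $+\infty$ is allowed for the $\liminf$ in (G1).) Then, for every $x\in\mathbb{R}$, $$\mathbf{P}\Big(\max_{i\in[d]}X_i\le a_n+b_nx\Big)\to F(x)\qquad(n\to\infty).$$ -/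

import Mathlib

open MeasureTheory ProbabilityTheory Filter Topology

namespace GaussExtremes

noncomputable section

/-- The closed (out-)neighbourhood `D_i` of a vertex `i` of a directed graph `D`. -/
def closedNhd {V : Type*} (D : Digraph V) (i : V) : Set V :=
  {j | j = i ∨ D.Adj i j}

/-- The pairs `(i, j)` with `j < i` and `j ∉ D_i` (weakly dependent pairs). -/
def weakPairs {d : ℕ} (D : Digraph (Fin d)) : Set (Fin d × Fin d) :=
  {p | p.2 < p.1 ∧ p.2 ∉ closedNhd D p.1}

open Classical in
/-- The set `{j : j < i, j ∈ D_i}` of strongly dependent predecessors of `i`. -/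
def strongPred {d : ℕ} (D : Digraph (Fin d)) (i : Fin d) : Finset (Fin d) :=
  Finset.univ.filter fun j => j < i ∧ j ∈ closedNhd D i

variable {Ω : Type*} [MeasurableSpace Ω]

/-- The correlation coefficient `cov(Y, Z) / √(Var Y * Var Z)`. -/
def corr (Y Z : Ω → ℝ) (P : Measure Ω) : ℝ :=
  cov[Y, Z; P] / Real.sqrt (Var[Y; P] * Var[Z; P])

/-- The standardisation `(t - E Y) / √(Var Y)` of the threshold `t` with respect to `Y`. -/
def stdThreshold (Y : Ω → ℝ) (P : Measure Ω) (t : ℝ) : ℝ :=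
  (t - ∫ ω, Y ω ∂P) / Real.sqrt (Var[Y; P])

/-- The `i`-th component of a random vector. -/
def comp {d : ℕ} (X : Ω → Fin d → ℝ) (i : Fin d) : Ω → ℝ := fun ω => X ω i

/-- `u_min`, the smallest of the standardised thresholds `u_i` of the components of `X`,
as an extended real (it is a minimum when `0 < d`). -/
def uMin {d : ℕ} (X : Ω → Fin d → ℝ) (P : Measure Ω) (t : ℝ) : EReal :=
  ⨅ i, ((stdThreshold (comp X i) P t : ℝ) : EReal)

/-- `max |r_ij|` over the pairs `j < i` with `j ∉ D_i`; it is `0` when there is no such pair. -/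
def maxWeakCorr {d : ℕ} (X : Ω → Fin d → ℝ) (P : Measure Ω) (D : Digraph (Fin d)) : ℝ :=
  ⨆ p : weakPairs D, |corr (comp X p.1.1) (comp X p.1.2) P|

/-- `max |r_ij|` over all pairs `i ≠ j`, as an extended real (`⊥` when there is no such pair). -/
def maxCorr {d : ℕ} (X : Ω → Fin d → ℝ) (P : Measure Ω) : EReal :=
  ⨆ i, ⨆ j, ⨆ _ : i ≠ j, ((|corr (comp X i) (comp X j) P| : ℝ) : EReal)

/-- The sum of `exp (-(u_i² + u_j²) / (2 (1 + |r_ij|)))` over the pairs `j < i` with `j ∈ D_i`. -/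
def strongSum {d : ℕ} (X : Ω → Fin d → ℝ) (P : Measure Ω) (t : ℝ) (D : Digraph (Fin d)) : ℝ :=
  ∑ i, ∑ j ∈ strongPred D i,
    Real.exp (-((stdThreshold (comp X i) P t) ^ 2 + (stdThreshold (comp X j) P t) ^ 2) /
      (2 * (1 + |corr (comp X i) (comp X j) P|)))

end

end GaussExtremes

namespace GaussExtremes

open scoped ENNReal NNReal

/-! The vector is compared with one having independent components and the same marginals. After
standardising, let `Y` be an independent standard Gaussian vector and rotate along `sin θ * X + cos
θ * Y` for `θ` from `0` to `π / 2`. Gaussian integration by parts turns the derivative in `θ` of a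
smoothed distribution function into a sum over pairs `i ≠ j`, each term carrying the factor `r_ij`.
Bounding the bivariate density on the quadrant beyond `(u_i, u_j)` gives a normal comparison
inequality (`abs_measureReal_sub_prod_le`): up to a constant depending on `ρ`, the error is the sum
over pairs of `|r_ij| exp (-(u_i² + u_j²) / (2 (1 + |r_ij|)))`.

Strongly dependent pairs vanish in the limit by assumption, as `|r_ij| ≤ 1`. For weakly dependent
pairs, replacing `|r_ij|` by its maximum `r` makes the sum factorise into at most `r (∑ exp (-u_i² /
(2 (1 + r))))²`. Since the product of the marginals has a positive limit, the sum of the tails at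
the `u_i` stays bounded. Mills ratio then gives `O(√(log d))` for the sum of exponentials
(`mul_sq_sum_exp_neg_sq_le`), so the contribution is `O(r log d)`, which tends to `0`. -/

/-! ### Gaussian integration by parts in one direction. -/

/-- Stein's identity for the standard Gaussian distribution. -/
theorem integral_id_mul_gaussianReal_eq {h h' : ℝ → ℝ} {C C' : ℝ}
    (hd : ∀ x, HasDerivAt h (h' x) x) (hm : Measurable h')
    (hC : ∀ x, |h x| ≤ C) (hC' : ∀ x, |h' x| ≤ C') :
    ∫ x, x * h x ∂(gaussianReal 0 1) = ∫ x, h' x ∂(gaussianReal 0 1) := by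
  have hcont : Continuous h := continuous_iff_continuousAt.2 fun x => (hd x).continuousAt
  rw [integral_gaussianReal_eq_integral_smul one_ne_zero,
    integral_gaussianReal_eq_integral_smul one_ne_zero]
  set g : ℝ → ℝ := gaussianPDFReal 0 1 with hg
  -- The density solves `g' = -x g`, so the identity is integration by parts on the line;
  -- integrability of `h * g` removes the boundary terms.
  have hgd : ∀ x, HasDerivAt g (-(x * g x)) x := by
    intro x
    have : HasDerivAt g ((√(2 * Real.pi * (1 : ℝ≥0)))⁻¹ *
        (Real.exp (-(x - 0) ^ 2 / (2 * (1 : ℝ≥0))) * (-(2 * x) / 2))) x := by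
      rw [hg, gaussianPDFReal_def]
      refine HasDerivAt.const_mul _ (HasDerivAt.exp ?_)
      simpa using (((hasDerivAt_id x).pow 2).neg.div_const 2)
    convert this using 1
    rw [hg, gaussianPDFReal_def]
    ring
  have hgi : Integrable g := integrable_gaussianPDFReal 0 1
  have hxg : Integrable fun x => x * g x := by
    have h2 : Integrable (fun x : ℝ => x) (gaussianReal 0 1) := by
      have := (memLp_id_gaussianReal (μ := 0) (v := 1) 1).integrable (by simp)
      exact this
    rw [gaussianReal_of_var_ne_zero _ one_ne_zero] at h2
    have := (integrable_withDensity_iff (measurable_gaussianPDF 0 1)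
      (ae_of_all _ fun _ => gaussianPDF_lt_top)).1 h2
    simpa [hg, toReal_gaussianPDF] using this
  have key := integral_mul_deriv_eq_deriv_mul_of_integrable (u := h) (v := g) (u' := h')
    (v' := fun x => -(x * g x)) (fun x _ => hd x) (fun x _ => hgd x)
    (hxg.neg.bdd_mul (c := C) hcont.aestronglyMeasurable (ae_of_all _ hC))
    (hgi.bdd_mul (c := C') hm.aestronglyMeasurable (ae_of_all _ hC'))
    (hgi.bdd_mul (c := C) hcont.aestronglyMeasurable (ae_of_all _ hC))
  have e1 : ∀ x, g x • (x * h x) = -(h x * -(x * g x)) := fun x => by simp; ring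
  have e2 : ∀ x, g x • h' x = h' x * g x := fun x => by simp; ring
  simp_rw [e1, e2, integral_neg]
  rw [key, neg_neg]

/-- Gaussian integration by parts in a direction that is independent of the remaining data. -/
theorem integral_mul_eq_of_indepFun {Ω β : Type*} [MeasurableSpace Ω] [MeasurableSpace β]
    {P : Measure Ω} [IsProbabilityMeasure P] {W : Ω → ℝ} {R : Ω → β}
    (hW : P.map W = gaussianReal 0 1) (hWm : AEMeasurable W P) (hR : AEMeasurable R P)
    (hind : IndepFun W R P) {Q Q' : ℝ → β → ℝ} {C C' : ℝ}
    (hQ : Measurable fun z : ℝ × β => Q z.1 z.2) (hQ' : Measurable fun z : ℝ × β => Q' z.1 z.2)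
    (hd : ∀ w r, HasDerivAt (fun w => Q w r) (Q' w r) w)
    (hC : ∀ w r, |Q w r| ≤ C) (hC' : ∀ w r, |Q' w r| ≤ C') :
    ∫ ω, W ω * Q (W ω) (R ω) ∂P = ∫ ω, Q' (W ω) (R ω) ∂P := by
  have hlaw := (indepFun_iff_map_prod_eq_prod_map_map hWm hR).1 hind
  have hpm : IsProbabilityMeasure (P.map R) := Measure.isProbabilityMeasure_map hR
  rw [hW] at hlaw
  have hpair : AEMeasurable (fun ω => (W ω, R ω)) P := hWm.prodMk hR
  have e1 : ∫ ω, W ω * Q (W ω) (R ω) ∂P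
      = ∫ z, z.1 * Q z.1 z.2 ∂((gaussianReal 0 1).prod (P.map R)) := by
    rw [← hlaw, integral_map hpair
      (by fun_prop : Measurable fun z : ℝ × β => z.1 * Q z.1 z.2).aestronglyMeasurable]
  have e2 : ∫ ω, Q' (W ω) (R ω) ∂P
      = ∫ z, Q' z.1 z.2 ∂((gaussianReal 0 1).prod (P.map R)) := by
    rw [← hlaw, integral_map hpair hQ'.aestronglyMeasurable]
  have h2 : Integrable (fun x : ℝ => x) (gaussianReal 0 1) :=
    (memLp_id_gaussianReal (μ := 0) (v := 1) 1).integrable (by simp)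
  -- Fubini with `w` innermost: for fixed `r` the one-dimensional identity applies.
  rw [e1, e2, integral_prod_symm, integral_prod_symm]
  · refine integral_congr_ae (ae_of_all _ fun r => ?_)
    exact integral_id_mul_gaussianReal_eq (fun w => hd w r)
      (hQ'.comp (measurable_id.prodMk measurable_const)) (fun w => hC w r) fun w => hC' w r
  · exact Integrable.of_bound hQ'.aestronglyMeasurable C' (ae_of_all _ fun z => hC' z.1 z.2)
  · exact (h2.comp_fst _).mul_bdd (c := C) hQ.aestronglyMeasurable
      (ae_of_all _ fun z => hC z.1 z.2)

/-! ### Bound for the bivariate Gaussian density on a quadrant. -/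

/-- The left side is the bivariate density with correlation `s`, written as marginal times
conditional density. Its exponent is `-(x² - 2sxy + y²) / (2(1 - s²))`; for `x, y ≥ 0` the bound
`2sxy ≤ |s|(x² + y²)` cancels a factor `1 - |s|`. The factors `1 / √(2π)` are bounded by `1`. -/
theorem gaussianPDFReal_mul_gaussianPDFReal_le {s u v x y : ℝ} (hs : |s| < 1) (hu : 0 ≤ u)
    (hv : 0 ≤ v) (hx : u ≤ x) (hy : v ≤ y) :
    gaussianPDFReal 0 1 x * gaussianPDFReal (s * x) (1 - s ^ 2).toNNReal y ≤
      (√(1 - s ^ 2))⁻¹ * Real.exp (-(u ^ 2 + v ^ 2) / (2 * (1 + |s|))) := by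
  have hs2 : 0 < 1 - s ^ 2 := by
    have := (sq_lt_one_iff_abs_lt_one s).2 hs
    linarith
  have h1s : 0 < 1 + |s| := by positivity
  simp only [gaussianPDFReal_def, Real.coe_toNNReal _ hs2.le, NNReal.coe_one, sub_zero, mul_one]
  rw [Real.sqrt_mul (by positivity : (0 : ℝ) ≤ 2 * Real.pi), mul_inv]
  have hpi : (√(2 * Real.pi))⁻¹ ≤ 1 := by
    apply inv_le_one_of_one_le₀
    rw [Real.one_le_sqrt]
    linarith [Real.pi_gt_three]
  have hexp : Real.exp (-x ^ 2 / 2) * Real.exp (-(y - s * x) ^ 2 / (2 * (1 - s ^ 2))) ≤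
      Real.exp (-(u ^ 2 + v ^ 2) / (2 * (1 + |s|))) := by
    rw [← Real.exp_add, Real.exp_le_exp]
    have h1 : -(x ^ 2 + y ^ 2) / (2 * (1 + |s|)) ≤ -(u ^ 2 + v ^ 2) / (2 * (1 + |s|)) := by
      gcongr
    refine le_trans ?_ h1
    have h3 : -x ^ 2 / 2 + -(y - s * x) ^ 2 / (2 * (1 - s ^ 2))
        = -(x ^ 2 - 2 * s * x * y + y ^ 2) / (2 * (1 - s ^ 2)) := by
      field_simp
      ring
    have h4 : -(x ^ 2 + y ^ 2) / (2 * (1 + |s|))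
        = -((x ^ 2 + y ^ 2) * (1 - |s|)) / (2 * (1 - s ^ 2)) := by
      have : 1 - s ^ 2 = (1 + |s|) * (1 - |s|) := by rw [← sq_abs]; ring
      rw [this]
      have : 1 - |s| ≠ 0 := by linarith
      field_simp
    rw [h3, h4]
    gcongr
    have h5 : s * (x * y) ≤ |s| * (x * y) :=
      mul_le_mul_of_nonneg_right (le_abs_self s)
        (mul_nonneg (hu.trans hx) (hv.trans hy))
    nlinarith [mul_nonneg (abs_nonneg s) (sq_nonneg (x - y))]
  calc _ = ((√(2 * Real.pi))⁻¹ * (√(2 * Real.pi))⁻¹) * (√(1 - s ^ 2))⁻¹ *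
        (Real.exp (-x ^ 2 / 2) * Real.exp (-(y - s * x) ^ 2 / (2 * (1 - s ^ 2)))) := by ring
    _ ≤ (1 * 1) * (√(1 - s ^ 2))⁻¹ * Real.exp (-(u ^ 2 + v ^ 2) / (2 * (1 + |s|))) := by
        gcongr
    _ = _ := by ring

/-- A bound by the maximum of the bivariate density for bumps to the right of `u` and `v`. -/
theorem lintegral_mul_le_of_hasGaussianLaw {Ω : Type*} [MeasurableSpace Ω]
    {P : Measure Ω} [IsProbabilityMeasure P] {U V : Ω → ℝ} {s u v : ℝ}
    (hUV : HasGaussianLaw (fun ω => (U ω, V ω)) P)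
    (hU : ∫ ω, U ω ∂P = 0) (hV : ∫ ω, V ω ∂P = 0) (hVU : Var[U; P] = 1) (hVV : Var[V; P] = 1)
    (hcov : cov[U, V; P] = s) (hs : |s| < 1) (hu : 0 ≤ u) (hv : 0 ≤ v)
    {p q : ℝ → ℝ≥0∞} (hp : Measurable p) (hq : Measurable q)
    (hpu : ∀ x < u, p x = 0) (hqv : ∀ x < v, q x = 0)
    (hp1 : ∫⁻ x, p x ≤ 1) (hq1 : ∫⁻ x, q x ≤ 1) :
    ∫⁻ ω, p (U ω) * q (V ω) ∂P ≤
      ENNReal.ofReal ((√(1 - s ^ 2))⁻¹ * Real.exp (-(u ^ 2 + v ^ 2) / (2 * (1 + |s|)))) := by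
  set K := (√(1 - s ^ 2))⁻¹ * Real.exp (-(u ^ 2 + v ^ 2) / (2 * (1 + |s|))) with hK
  have hs2 : 0 < 1 - s ^ 2 := by
    have := (sq_lt_one_iff_abs_lt_one s).2 hs
    linarith
  have hUg := hUV.fst
  have hVg := hUV.snd
  -- The residual `V - s * U` is uncorrelated with `U`, hence independent, with variance `1 - s²`;
  -- this gives the conditional law of `V` given `U`.
  have hUR : HasGaussianLaw (fun ω => (U ω, V ω - s * U ω)) P :=
    hUV.map_fun ((ContinuousLinearMap.fst ℝ ℝ ℝ).prod
      (ContinuousLinearMap.snd ℝ ℝ ℝ - s • ContinuousLinearMap.fst ℝ ℝ ℝ))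
  have hRg := hUR.snd
  have hU2 := hUg.memLp_two
  have hV2 := hVg.memLp_two
  have hcR : cov[U, fun ω => V ω - s * U ω; P] = 0 := by
    rw [covariance_fun_sub_right hU2 hV2 (hU2.const_mul s), covariance_const_mul_right,
      covariance_self hU2.aemeasurable, hVU, hcov]
    ring
  have hRm : ∫ ω, (V ω - s * U ω) ∂P = 0 := by
    rw [integral_sub hVg.integrable (hUg.integrable.const_mul s), integral_const_mul, hU, hV]
    simp
  have hVR : Var[fun ω => V ω - s * U ω; P] = 1 - s ^ 2 := by
    rw [← covariance_self hRg.aemeasurable,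
      covariance_fun_sub_left hV2 (hU2.const_mul s) hRg.memLp_two,
      covariance_const_mul_left, hcR, covariance_fun_sub_right hV2 hV2 (hU2.const_mul s),
      covariance_const_mul_right, covariance_self hV2.aemeasurable, hVV, covariance_comm, hcov]
    ring
  have hind := hUR.indepFun_of_covariance_eq_zero hcR
  have hlaw := (indepFun_iff_map_prod_eq_prod_map_map hUg.aemeasurable hRg.aemeasurable).1 hind
  rw [hUg.map_eq_gaussianReal, hRg.map_eq_gaussianReal, hU, hRm, hVU, hVR, Real.toNNReal_one]
    at hlaw
  have hne : (1 - s ^ 2).toNNReal ≠ 0 := by simpa using hs2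
  have hmeas : Measurable fun z : ℝ × ℝ => p z.1 * q (s * z.1 + z.2) :=
    (hp.comp measurable_fst).mul (hq.comp (by fun_prop))
  have e1 : ∫⁻ ω, p (U ω) * q (V ω) ∂P = ∫⁻ z, p z.1 * q (s * z.1 + z.2)
      ∂((gaussianReal 0 1).prod (gaussianReal 0 (1 - s ^ 2).toNNReal)) := by
    rw [← hlaw, lintegral_map' hmeas.aemeasurable hUR.aemeasurable]
    simp
  have e2 : ∀ x : ℝ, ∫⁻ r, p x * q (s * x + r) ∂(gaussianReal 0 (1 - s ^ 2).toNNReal)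
      = p x * ∫⁻ y, gaussianPDF (s * x) (1 - s ^ 2).toNNReal y * q y := by
    intro x
    rw [lintegral_const_mul _ (by fun_prop : Measurable fun r => q (s * x + r))]
    have : gaussianReal (s * x) (1 - s ^ 2).toNNReal
        = (gaussianReal 0 (1 - s ^ 2).toNNReal).map (fun r => s * x + r) := by
      rw [gaussianReal_map_const_add, zero_add]
    rw [← lintegral_map hq (by fun_prop : Measurable fun r => s * x + r), ← this,
      gaussianReal_of_var_ne_zero _ hne, lintegral_withDensity_eq_lintegral_mul _
        (measurable_gaussianPDF _ _) hq]
    rfl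
  have hin : Measurable fun x : ℝ => p x * ∫⁻ y, gaussianPDF (s * x) (1 - s ^ 2).toNNReal y * q y := by
    simp_rw [← e2]
    exact hmeas.lintegral_prod_right'
  rw [e1, lintegral_prod _ hmeas.aemeasurable]
  simp_rw [e2]
  rw [gaussianReal_of_var_ne_zero _ one_ne_zero,
    lintegral_withDensity_eq_lintegral_mul _ (measurable_gaussianPDF _ _) hin]
  have hbound : ∀ x, (gaussianPDF 0 1 * fun x => p x *
      ∫⁻ y, gaussianPDF (s * x) (1 - s ^ 2).toNNReal y * q y) x ≤ p x * ENNReal.ofReal K := by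
    intro x
    by_cases hx : x < u
    · simp [hpu x hx]
    push Not at hx
    have : gaussianPDF 0 1 x * ∫⁻ y, gaussianPDF (s * x) (1 - s ^ 2).toNNReal y * q y
        ≤ ENNReal.ofReal K := by
      have hm : Measurable fun y : ℝ => gaussianPDF (s * x) (1 - s ^ 2).toNNReal y * q y :=
        (measurable_gaussianPDF _ _).mul hq
      rw [← lintegral_const_mul _ hm]
      calc _ ≤ ∫⁻ y, ENNReal.ofReal K * q y := by
            refine lintegral_mono fun y => ?_
            by_cases hy : y < v
            · simp [hqv y hy]
            push Not at hy
            rw [← mul_assoc]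
            gcongr
            rw [gaussianPDF_def, gaussianPDF_def,
              ← ENNReal.ofReal_mul (gaussianPDFReal_nonneg _ _ _)]
            exact ENNReal.ofReal_le_ofReal
              (gaussianPDFReal_mul_gaussianPDFReal_le hs hu hv hx hy)
        _ = ENNReal.ofReal K * ∫⁻ y, q y := lintegral_const_mul _ hq
        _ ≤ ENNReal.ofReal K * 1 := by gcongr
        _ = _ := mul_one _
    calc _ = p x * (gaussianPDF 0 1 x *
          ∫⁻ y, gaussianPDF (s * x) (1 - s ^ 2).toNNReal y * q y) := by
          simp only [Pi.mul_apply]; ring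
      _ ≤ _ := by gcongr
  calc _ ≤ ∫⁻ x, p x * ENNReal.ofReal K := lintegral_mono hbound
    _ = (∫⁻ x, p x) * ENNReal.ofReal K := lintegral_mul_const _ hp
    _ ≤ 1 * ENNReal.ofReal K := by gcongr
    _ = _ := one_mul _

/-! ### Product functions of a Gaussian vector and the rotation path. -/

open Finset in
/-- Gaussian integration by parts for a product function of a Gaussian vector. -/
theorem integral_mul_prod_eq_sum {Ω ι : Type*} [MeasurableSpace Ω] [Fintype ι] [DecidableEq ι]
    {P : Measure Ω} [IsProbabilityMeasure P] {W : Ω → ℝ} {Z : Ω → ι → ℝ} {c : ι → ℝ} {i : ι}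
    (hWZ : HasGaussianLaw (fun ω => (W ω, Z ω)) P)
    (hW0 : ∫ ω, W ω ∂P = 0) (hW1 : Var[W; P] = 1)
    (hc : ∀ j, cov[W, fun ω => Z ω j; P] = c j) (hci : c i = 0)
    {f f' : ι → ℝ → ℝ} {C : ℝ} (hd : ∀ k x, HasDerivAt (f k) (f' k x) x)
    (hf'c : ∀ k, Continuous (f' k)) (hf0 : ∀ k x, 0 ≤ f k x) (hf1 : ∀ k x, f k x ≤ 1)
    (hC : ∀ k x, |f' k x| ≤ C) :
    ∫ ω, W ω * (f' i (Z ω i) * ∏ k ∈ univ.erase i, f k (Z ω k)) ∂P =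
      ∑ j ∈ univ.erase i, c j * ∫ ω, f' i (Z ω i) * f' j (Z ω j) *
        ∏ k ∈ (univ.erase i).erase j, f k (Z ω k) ∂P := by
  have hfc : ∀ k, Continuous (f k) := fun k =>
    continuous_iff_continuousAt.2 fun x => (hd k x).continuousAt
  have hC0 : 0 ≤ C := (abs_nonneg _).trans (hC i 0)
  have hWg := hWZ.fst
  have hZg := hWZ.snd
  have hZig : ∀ j, HasGaussianLaw (fun ω => Z ω j) P := fun j => hZg.eval j
  have hpabs : ∀ (s : Finset ι) (z : ι → ℝ), |∏ k ∈ s, f k (z k)| ≤ 1 := fun s z => by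
    rw [abs_of_nonneg (prod_nonneg fun k _ => hf0 k _)]
    exact prod_le_one (fun k _ => hf0 k _) fun k _ => hf1 k _
  set R : Ω → ι → ℝ := fun ω j => Z ω j - c j * W ω with hR
  have hWR : HasGaussianLaw (fun ω => ((fun _ : Unit => W ω), fun j => Z ω j - c j * W ω)) P := by
    let T : ℝ × (ι → ℝ) →L[ℝ] (Unit → ℝ) × (ι → ℝ) :=
      (ContinuousLinearMap.pi fun _ => ContinuousLinearMap.fst ℝ ℝ (ι → ℝ)).prod
      (ContinuousLinearMap.pi fun j =>
        (ContinuousLinearMap.proj j).comp (ContinuousLinearMap.snd ℝ ℝ (ι → ℝ)) -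
          c j • ContinuousLinearMap.fst ℝ ℝ (ι → ℝ))
    exact hWZ.map_fun T
  have hind : IndepFun W R P := by
    have := hWR.indepFun_of_covariance_eval (X := fun _ : Unit => W)
      (Y := fun j ω => Z ω j - c j * W ω) fun _ j => by
        rw [covariance_fun_sub_right hWg.memLp_two (hZig j).memLp_two
          (hWg.memLp_two.const_mul _), covariance_const_mul_right,
          covariance_self hWg.aemeasurable, hW1, hc j]
        ring
    exact this.comp (measurable_pi_apply ()) measurable_id
  have hWlaw : P.map W = gaussianReal 0 1 := by
    rw [hWg.map_eq_gaussianReal, hW0, hW1, Real.toNNReal_one]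
  have hRm : AEMeasurable R P := hWR.snd.aemeasurable
  -- Write `Z = R + c W` with `R` independent of `W`. As `c i = 0`, the factor `f' i (Z i)` does not
  -- depend on `w`, so no second derivative of `f i` is needed.
  have key := integral_mul_eq_of_indepFun (P := P) (C := C)
    (C' := C * ∑ j ∈ univ.erase i, C * |c j|) hWlaw hWg.aemeasurable hRm hind
    (Q := fun w r => f' i (r i) * ∏ k ∈ univ.erase i, f k (r k + c k * w))
    (Q' := fun w r => f' i (r i) * ∑ j ∈ univ.erase i,
      (∏ k ∈ (univ.erase i).erase j, f k (r k + c k * w)) * (f' j (r j + c j * w) * c j))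
    (by fun_prop) (by fun_prop) ?_ ?_ ?_
  · have hRZ : ∀ ω j, R ω j + c j * W ω = Z ω j := fun ω j => by simp [hR]
    have hRi : ∀ ω, R ω i = Z ω i := fun ω => by simp [hR, hci]
    simp only [hRZ, hRi] at key
    rw [key]
    simp_rw [mul_sum]
    rw [integral_finsetSum]
    · refine sum_congr rfl fun j _ => ?_
      rw [← integral_const_mul]
      refine integral_congr_ae (ae_of_all _ fun ω => ?_)
      simp only
      ring
    · intro j _
      refine Integrable.of_bound (C := C * (1 * (C * |c j|))) ?_ (ae_of_all _ fun ω => ?_)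
      · have : ∀ j, AEMeasurable (fun ω => Z ω j) P := fun j => (hZig j).aemeasurable
        have h1 : ∀ j, AEMeasurable (fun ω => f j (Z ω j)) P := fun j =>
          (hfc j).measurable.comp_aemeasurable (this j)
        have h2 : ∀ j, AEMeasurable (fun ω => f' j (Z ω j)) P := fun j =>
          (hf'c j).measurable.comp_aemeasurable (this j)
        refine AEMeasurable.aestronglyMeasurable ?_
        exact (h2 i).mul ((Finset.aemeasurable_fun_prod _ fun k _ => h1 k).mul
          ((h2 j).mul_const _))
      · rw [Real.norm_eq_abs, abs_mul, abs_mul, abs_mul]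
        gcongr
        · exact hC _ _
        · exact hpabs _ _
        · exact hC _ _
  · intro w r
    refine HasDerivAt.const_mul _ ?_
    have := HasDerivAt.fun_finsetProd (u := univ.erase i)
      (f := fun k w => f k (r k + c k * w)) (f' := fun k => f' k (r k + c k * w) * c k) (x := w)
      fun k _ => (hd k (r k + c k * w)).comp w
        (by simpa using ((hasDerivAt_id w).const_mul (c k)).const_add (r k))
    simpa only [smul_eq_mul] using this
  · intro w r
    rw [abs_mul]
    exact (mul_le_mul (hC _ _) (hpabs _ fun k => r k + c k * w) (abs_nonneg _) hC0).trans_eq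
      (mul_one C)
  · intro w r
    rw [abs_mul]
    gcongr
    · exact hC _ _
    · refine (abs_sum_le_sum_abs _ _).trans (sum_le_sum fun j _ => ?_)
      rw [abs_mul, abs_mul, ← one_mul (C * |c j|)]
      gcongr
      · exact hpabs _ fun k => r k + c k * w
      · exact hC _ _

open Finset in
/-- Differentiation of the expectation of a product function along the rotation path. -/
theorem hasDerivAt_integral_prod_rotation {Ω ι : Type*} [MeasurableSpace Ω] [Fintype ι]
    [DecidableEq ι] {P : Measure Ω} [IsProbabilityMeasure P] {X Y : Ω → ι → ℝ}
    (hX : ∀ i, Integrable (fun ω => X ω i) P) (hY : ∀ i, Integrable (fun ω => Y ω i) P)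
    {f f' : ι → ℝ → ℝ} {C : ℝ} (hd : ∀ k x, HasDerivAt (f k) (f' k x) x)
    (hf'c : ∀ k, Continuous (f' k)) (hf0 : ∀ k x, 0 ≤ f k x) (hf1 : ∀ k x, f k x ≤ 1)
    (hC : ∀ k x, |f' k x| ≤ C) (θ : ℝ) :
    HasDerivAt (fun θ => ∫ ω, ∏ k, f k (Real.sin θ * X ω k + Real.cos θ * Y ω k) ∂P)
      (∑ i, ∫ ω, (Real.cos θ * X ω i - Real.sin θ * Y ω i) *
        (f' i (Real.sin θ * X ω i + Real.cos θ * Y ω i) *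
          ∏ k ∈ univ.erase i, f k (Real.sin θ * X ω k + Real.cos θ * Y ω k)) ∂P) θ := by
  have hfc : ∀ k, Continuous (f k) := fun k =>
    continuous_iff_continuousAt.2 fun x => (hd k x).continuousAt
  have hpabs : ∀ (s : Finset ι) (z : ι → ℝ), |∏ k ∈ s, f k (z k)| ≤ 1 := fun s z => by
    rw [abs_of_nonneg (prod_nonneg fun k _ => hf0 k _)]
    exact prod_le_one (fun k _ => hf0 k _) fun k _ => hf1 k _
  have hXm : ∀ i, AEMeasurable (fun ω => X ω i) P := fun i => (hX i).aemeasurable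
  have hYm : ∀ i, AEMeasurable (fun ω => Y ω i) P := fun i => (hY i).aemeasurable
  have hZm : ∀ (θ : ℝ) i, AEMeasurable (fun ω => Real.sin θ * X ω i + Real.cos θ * Y ω i) P :=
    fun θ i => ((hXm i).const_mul _).add ((hYm i).const_mul _)
  have hfm : ∀ (θ : ℝ) i,
      AEMeasurable (fun ω => f i (Real.sin θ * X ω i + Real.cos θ * Y ω i)) P :=
    fun θ i => (hfc i).measurable.comp_aemeasurable (hZm θ i)
  have hFm : ∀ θ : ℝ, AEStronglyMeasurable
      (fun ω => ∏ k, f k (Real.sin θ * X ω k + Real.cos θ * Y ω k)) P := fun θ =>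
    (Finset.aemeasurable_fun_prod _ fun k _ => hfm θ k).aestronglyMeasurable
  have hTm : ∀ i, AEStronglyMeasurable (fun ω => (Real.cos θ * X ω i - Real.sin θ * Y ω i) *
        (f' i (Real.sin θ * X ω i + Real.cos θ * Y ω i) *
          ∏ k ∈ univ.erase i, f k (Real.sin θ * X ω k + Real.cos θ * Y ω k))) P := fun i =>
    ((((hXm i).const_mul _).sub ((hYm i).const_mul _)).mul
      (((hf'c i).measurable.comp_aemeasurable (hZm θ i)).mul
        (Finset.aemeasurable_fun_prod _ fun k _ => hfm θ k))).aestronglyMeasurable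
  -- The bound does not involve `θ`, so it dominates the differentiation under the integral.
  have hTb : ∀ (θ : ℝ) i ω, |(Real.cos θ * X ω i - Real.sin θ * Y ω i) *
        (f' i (Real.sin θ * X ω i + Real.cos θ * Y ω i) *
          ∏ k ∈ univ.erase i, f k (Real.sin θ * X ω k + Real.cos θ * Y ω k))| ≤
      (|X ω i| + |Y ω i|) * (C * 1) := by
    intro θ i ω
    rw [abs_mul, abs_mul]
    have hC0 : 0 ≤ C := (abs_nonneg _).trans (hC i 0)
    gcongr
    · refine (abs_sub _ _).trans ?_
      rw [abs_mul, abs_mul]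
      exact add_le_add (mul_le_of_le_one_left (abs_nonneg _) (Real.abs_cos_le_one θ))
        (mul_le_of_le_one_left (abs_nonneg _) (Real.abs_sin_le_one θ))
    · exact hC _ _
    · exact hpabs _ fun k => Real.sin θ * X ω k + Real.cos θ * Y ω k
  have hbi : ∀ i, Integrable (fun ω => (|X ω i| + |Y ω i|) * (C * 1)) P := fun i =>
    ((hX i).abs.add (hY i).abs).mul_const _
  have hTi : ∀ i, Integrable (fun ω => (Real.cos θ * X ω i - Real.sin θ * Y ω i) *
        (f' i (Real.sin θ * X ω i + Real.cos θ * Y ω i) *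
          ∏ k ∈ univ.erase i, f k (Real.sin θ * X ω k + Real.cos θ * Y ω k))) P := fun i =>
    (hbi i).mono' (hTm i) (ae_of_all _ fun ω => hTb θ i ω)
  rw [← integral_finsetSum _ fun i _ => hTi i]
  refine (hasDerivAt_integral_of_dominated_loc_of_deriv_le (𝕜 := ℝ) (s := Set.univ)
    (F := fun θ ω => ∏ k, f k (Real.sin θ * X ω k + Real.cos θ * Y ω k))
    (F' := fun θ ω => ∑ i, (Real.cos θ * X ω i - Real.sin θ * Y ω i) *
        (f' i (Real.sin θ * X ω i + Real.cos θ * Y ω i) *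
          ∏ k ∈ univ.erase i, f k (Real.sin θ * X ω k + Real.cos θ * Y ω k)))
    (bound := fun ω => ∑ i, (|X ω i| + |Y ω i|) * (C * 1))
    Filter.univ_mem (Eventually.of_forall hFm) ?_ ?_ ?_ ?_ ?_).2
  · exact Integrable.of_bound (hFm θ) 1 (ae_of_all _ fun ω =>
      hpabs _ fun k => Real.sin θ * X ω k + Real.cos θ * Y ω k)
  · exact (integrable_finsetSum _ fun i _ => hTi i).aestronglyMeasurable
  · exact ae_of_all _ fun ω θ _ => (abs_sum_le_sum_abs _ _).trans
      (sum_le_sum fun i _ => hTb θ i ω)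
  · exact integrable_finsetSum _ fun i _ => hbi i
  · refine ae_of_all _ fun ω θ _ => ?_
    have := HasDerivAt.fun_finsetProd (u := univ)
      (f := fun k θ => f k (Real.sin θ * X ω k + Real.cos θ * Y ω k))
      (f' := fun k => f' k (Real.sin θ * X ω k + Real.cos θ * Y ω k) *
        (Real.cos θ * X ω k + -Real.sin θ * Y ω k)) (x := θ)
      fun k _ => (hd k (Real.sin θ * X ω k + Real.cos θ * Y ω k)).comp θ
        (((Real.hasDerivAt_sin θ).mul_const (X ω k)).add
          ((Real.hasDerivAt_cos θ).mul_const (Y ω k)))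
    refine this.congr_deriv (Finset.sum_congr rfl fun i _ => ?_)
    rw [smul_eq_mul]
    ring

/-- Along the path the correlation is `s = sin² θ * r`; this makes the density bound uniform in `θ`.
-/
theorem inv_sqrt_mul_exp_mono {s r ρ u v : ℝ} (hsr : |s| ≤ |r|) (hr : |r| ≤ ρ) (hρ : ρ < 1) :
    (√(1 - s ^ 2))⁻¹ * Real.exp (-(u ^ 2 + v ^ 2) / (2 * (1 + |s|))) ≤
      (√(1 - ρ ^ 2))⁻¹ * Real.exp (-(u ^ 2 + v ^ 2) / (2 * (1 + |r|))) := by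
  have hρ0 : 0 ≤ ρ := (abs_nonneg r).trans hr
  have h2 : 0 < 1 - ρ ^ 2 := by nlinarith
  have h3 : s ^ 2 ≤ ρ ^ 2 := sq_le_sq' (by linarith [neg_abs_le s]) (by linarith [le_abs_self s])
  have h4 : 0 < √(1 - ρ ^ 2) := Real.sqrt_pos.2 h2
  have h5 : (u ^ 2 + v ^ 2) / (2 * (1 + |r|)) ≤ (u ^ 2 + v ^ 2) / (2 * (1 + |s|)) := by gcongr
  rw [neg_div, neg_div]
  gcongr

/-! ### Smooth approximations of the indicator of a half-line. -/

/-- A smooth decreasing step from `1` to `0` on the interval `[u, u + ε]`. -/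
noncomputable def smoothStep (ε u x : ℝ) : ℝ := 1 - Real.smoothTransition ((x - u) / ε)

/-- The derivative of `smoothStep`. -/
noncomputable def smoothStepDeriv (ε u x : ℝ) : ℝ :=
  -(deriv Real.smoothTransition ((x - u) / ε) / ε)

theorem smoothStep_nonneg (ε u x : ℝ) : 0 ≤ smoothStep ε u x :=
  sub_nonneg.2 (Real.smoothTransition.le_one _)

theorem smoothStep_le_one (ε u x : ℝ) : smoothStep ε u x ≤ 1 :=
  sub_le_self _ (Real.smoothTransition.nonneg _)

theorem hasDerivAt_smoothStep (ε u x : ℝ) :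
    HasDerivAt (smoothStep ε u) (smoothStepDeriv ε u x) x := by
  have h1 : HasDerivAt (fun x : ℝ => (x - u) / ε) (1 / ε) x :=
    ((hasDerivAt_id x).sub_const u).div_const ε
  have h2 : HasDerivAt Real.smoothTransition (deriv Real.smoothTransition ((x - u) / ε))
      ((x - u) / ε) :=
    ((Real.smoothTransition.contDiff (n := 1)).differentiable (by simp) _).hasDerivAt
  have := (h2.comp x h1).const_sub 1
  rw [mul_one_div] at this
  exact this

theorem continuous_deriv_smoothTransition : Continuous (deriv Real.smoothTransition) :=
  (Real.smoothTransition.contDiff (n := 1)).continuous_deriv (by simp)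

theorem deriv_smoothTransition_of_neg {x : ℝ} (hx : x < 0) :
    deriv Real.smoothTransition x = 0 := by
  have : Real.smoothTransition =ᶠ[𝓝 x] fun _ => 0 := by
    filter_upwards [gt_mem_nhds hx] with y hy
    exact Real.smoothTransition.zero_of_nonpos hy.le
  rw [this.deriv_eq, deriv_const]

theorem deriv_smoothTransition_of_one_lt {x : ℝ} (hx : 1 < x) :
    deriv Real.smoothTransition x = 0 := by
  have : Real.smoothTransition =ᶠ[𝓝 x] fun _ => 1 := by
    filter_upwards [lt_mem_nhds hx] with y hy
    exact Real.smoothTransition.one_of_one_le hy.le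
  rw [this.deriv_eq, deriv_const]

theorem hasCompactSupport_deriv_smoothTransition :
    HasCompactSupport (deriv Real.smoothTransition) := by
  refine HasCompactSupport.intro (isCompact_Icc (a := (0 : ℝ)) (b := 1)) fun x hx => ?_
  rw [Set.mem_Icc, not_and_or, not_le, not_le] at hx
  exact hx.elim deriv_smoothTransition_of_neg deriv_smoothTransition_of_one_lt

theorem continuous_smoothStepDeriv (ε u : ℝ) : Continuous (smoothStepDeriv ε u) := by
  have := continuous_deriv_smoothTransition
  unfold smoothStepDeriv
  fun_prop

theorem exists_abs_smoothStepDeriv_le (ε : ℝ) : ∃ C, ∀ u x, |smoothStepDeriv ε u x| ≤ C := by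
  obtain ⟨C, hC⟩ := hasCompactSupport_deriv_smoothTransition.exists_bound_of_continuous
    continuous_deriv_smoothTransition
  refine ⟨C / |ε|, fun u x => ?_⟩
  rw [smoothStepDeriv, abs_neg, abs_div]
  gcongr
  exact hC _

theorem smoothStepDeriv_of_lt {ε u x : ℝ} (hε : 0 < ε) (hx : x < u) :
    smoothStepDeriv ε u x = 0 := by
  rw [smoothStepDeriv, deriv_smoothTransition_of_neg (div_neg_of_neg_of_pos (by linarith) hε)]
  simp

theorem integral_deriv_smoothTransition : ∫ x, deriv Real.smoothTransition x = 1 := by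
  rw [integral_of_hasDerivAt_of_tendsto (f := Real.smoothTransition) (m := 0) (n := 1)
    (fun x => ((Real.smoothTransition.contDiff (n := 1)).differentiable (by simp) x).hasDerivAt)
    (continuous_deriv_smoothTransition.integrable_of_hasCompactSupport
      hasCompactSupport_deriv_smoothTransition)]
  · simp
  · refine tendsto_const_nhds.congr' ?_
    filter_upwards [eventually_le_atBot 0] with x hx
    exact (Real.smoothTransition.zero_of_nonpos hx).symm
  · refine tendsto_const_nhds.congr' ?_
    filter_upwards [eventually_ge_atTop 1] with x hx
    exact (Real.smoothTransition.one_of_one_le hx).symm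

theorem lintegral_abs_smoothStepDeriv {ε : ℝ} (hε : 0 < ε) (u : ℝ) :
    ∫⁻ x, ENNReal.ofReal |smoothStepDeriv ε u x| = 1 := by
  have h0 : ∀ x, 0 ≤ deriv Real.smoothTransition x := fun x =>
    Real.smoothTransition.monotone.deriv_nonneg
  have hi : Integrable (deriv Real.smoothTransition) :=
    continuous_deriv_smoothTransition.integrable_of_hasCompactSupport
      hasCompactSupport_deriv_smoothTransition
  have e : ∀ x, |smoothStepDeriv ε u x| = deriv Real.smoothTransition ((x - u) / ε) / ε :=
    fun x => by rw [smoothStepDeriv, abs_neg, abs_of_nonneg (div_nonneg (h0 _) hε.le)]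
  have hi2 : Integrable fun x => deriv Real.smoothTransition ((x - u) / ε) / ε :=
    ((hi.comp_div hε.ne').comp_sub_right u).div_const ε
  simp_rw [e]
  rw [← ofReal_integral_eq_lintegral_ofReal hi2
    (ae_of_all _ fun x => div_nonneg (h0 _) hε.le), integral_div,
    integral_sub_right_eq_self (fun x => deriv Real.smoothTransition (x / ε)) u,
    Measure.integral_comp_div (fun x => deriv Real.smoothTransition x) ε,
    integral_deriv_smoothTransition]
  simp [abs_of_pos hε, hε.ne']

/-- The step equals `1` up to and including `u` and drops only to its right. Hence the limit is the
indicator of the closed half-line, and the derivatives live on `[u, ∞)`, where the density bound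
applies. -/
theorem tendsto_smoothStep (u x : ℝ) :
    Tendsto (fun n : ℕ => smoothStep (1 / ((n : ℝ) + 1)) u x) atTop
      (𝓝 (Set.indicator (Set.Iic u) 1 x)) := by
  by_cases hx : x ≤ u
  · rw [Set.indicator_of_mem (by exact hx)]
    refine tendsto_const_nhds.congr fun n => ?_
    rw [smoothStep, Real.smoothTransition.zero_of_nonpos]
    · simp
    · exact div_nonpos_of_nonpos_of_nonneg (by linarith) (by positivity)
  · rw [Set.indicator_of_notMem (by exact hx)]
    refine tendsto_const_nhds.congr' ?_
    push Not at hx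
    obtain ⟨N, hN⟩ := exists_nat_one_div_lt (sub_pos.2 hx)
    filter_upwards [eventually_ge_atTop N] with n hn
    rw [smoothStep, Real.smoothTransition.one_of_one_le, sub_self]
    rw [one_le_div (by positivity)]
    refine le_trans ?_ hN.le
    gcongr

/-! ### The normal comparison inequality. -/

open Finset in
/-- Comparison of smoothed distribution functions of a correlated and an uncorrelated vector. -/
theorem abs_integral_prod_sub_le {Ω ι : Type*} [MeasurableSpace Ω] [Fintype ι] [DecidableEq ι]
    {P : Measure Ω} [IsProbabilityMeasure P] {X Y : Ω → ι → ℝ} {r : ι → ι → ℝ} {ρ : ℝ}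
    {u : ι → ℝ}
    (hXY : HasGaussianLaw (fun ω => (X ω, Y ω)) P)
    (hX0 : ∀ i, ∫ ω, X ω i ∂P = 0) (hY0 : ∀ i, ∫ ω, Y ω i ∂P = 0)
    (hXX : ∀ i j, cov[fun ω => X ω i, fun ω => X ω j; P] = r i j) (hr : ∀ i, r i i = 1)
    (hYY : ∀ i j, cov[fun ω => Y ω i, fun ω => Y ω j; P] = if i = j then 1 else 0)
    (hXYc : ∀ i j, cov[fun ω => X ω i, fun ω => Y ω j; P] = 0)
    (hρ : ρ < 1) (hrρ : ∀ i j, i ≠ j → |r i j| ≤ ρ) (hu : ∀ i, 0 ≤ u i)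
    {f f' : ι → ℝ → ℝ} {C : ℝ} (hd : ∀ k x, HasDerivAt (f k) (f' k x) x)
    (hf'c : ∀ k, Continuous (f' k)) (hf0 : ∀ k x, 0 ≤ f k x) (hf1 : ∀ k x, f k x ≤ 1)
    (hC : ∀ k x, |f' k x| ≤ C) (hfu : ∀ k, ∀ x < u k, f' k x = 0)
    (hfi : ∀ k, ∫⁻ x, ENNReal.ofReal |f' k x| ≤ 1) :
    |∫ ω, ∏ k, f k (X ω k) ∂P - ∫ ω, ∏ k, f k (Y ω k) ∂P| ≤
      (∑ i, ∑ j ∈ univ.erase i, |r i j| * ((√(1 - ρ ^ 2))⁻¹ *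
        Real.exp (-(u i ^ 2 + u j ^ 2) / (2 * (1 + |r i j|))))) * (Real.pi / 2) := by
  have hXg : ∀ i, HasGaussianLaw (fun ω => X ω i) P := fun i => hXY.fst.eval i
  have hYg : ∀ i, HasGaussianLaw (fun ω => Y ω i) P := fun i => hXY.snd.eval i
  have hX2 := fun i => (hXg i).memLp_two
  have hY2 := fun i => (hYg i).memLp_two
  have hYXc : ∀ i j, cov[fun ω => Y ω i, fun ω => X ω j; P] = 0 := fun i j => by
    rw [covariance_comm, hXYc]
  have hcov : ∀ (a b c d : ℝ) i j, cov[fun ω => a * X ω i + b * Y ω i,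
      fun ω => c * X ω j + d * Y ω j; P] = a * c * r i j + b * d * if i = j then 1 else 0 := by
    intro a b c d i j
    have h1 := (hX2 i).const_mul a
    have h2 := (hY2 i).const_mul b
    have h3 := (hX2 j).const_mul c
    have h4 := (hY2 j).const_mul d
    have := covariance_add_left h1 h2 (h3.add h4)
    refine this.trans ?_
    rw [covariance_add_right h1 h3 h4, covariance_add_right h2 h3 h4]
    simp only [covariance_const_mul_left, covariance_const_mul_right, hXX, hYY, hXYc, hYXc]
    ring
  have hmean : ∀ (a b : ℝ) i, ∫ ω, (a * X ω i + b * Y ω i) ∂P = 0 := by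
    intro a b i
    rw [integral_add ((hXg i).integrable.const_mul a) ((hYg i).integrable.const_mul b),
      integral_const_mul, integral_const_mul, hX0, hY0]
    simp
  have hvar : ∀ (a b : ℝ) i, Var[fun ω => a * X ω i + b * Y ω i; P] = a ^ 2 + b ^ 2 := by
    intro a b i
    have h2 : AEMeasurable (fun ω => a * X ω i + b * Y ω i) P :=
      (((hX2 i).const_mul a).add ((hY2 i).const_mul b)).aemeasurable
    rw [← covariance_self h2, hcov, hr, if_pos rfl]
    ring
  set S : ι → ι → ℝ := fun i j => |r i j| * ((√(1 - ρ ^ 2))⁻¹ *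
        Real.exp (-(u i ^ 2 + u j ^ 2) / (2 * (1 + |r i j|)))) with hS
  have hderiv := hasDerivAt_integral_prod_rotation (fun i => (hXg i).integrable)
    (fun i => (hYg i).integrable) hd hf'c hf0 hf1 hC
  -- Mean value inequality between `θ = 0`, where the path is at `Y`, and `θ = π / 2`, where it is
  -- at `X`; the length of the interval is the final factor.
  have key := norm_image_sub_le_of_norm_deriv_le_segment' (a := 0) (b := Real.pi / 2)
    (C := ∑ i, ∑ j ∈ univ.erase i, S i j)
    (fun θ _ => (hderiv θ).hasDerivWithinAt) ?_ (Real.pi / 2)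
    (Set.right_mem_Icc.2 (by positivity))
  · simp only [Real.sin_pi_div_two, Real.cos_pi_div_two, Real.sin_zero, Real.cos_zero, one_mul,
      zero_mul, add_zero, zero_add, sub_zero, Real.norm_eq_abs] at key
    exact key
  intro θ _
  rw [Real.norm_eq_abs]
  refine (abs_sum_le_sum_abs _ _).trans (sum_le_sum fun i _ => ?_)
  let T : (ι → ℝ) × (ι → ℝ) →L[ℝ] ℝ × (ι → ℝ) :=
    (Real.cos θ • (ContinuousLinearMap.proj (R := ℝ) (φ := fun _ : ι => ℝ) i).comp
        (ContinuousLinearMap.fst ℝ _ _) -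
      Real.sin θ • (ContinuousLinearMap.proj (R := ℝ) (φ := fun _ : ι => ℝ) i).comp
        (ContinuousLinearMap.snd ℝ _ _)).prod
    (Real.sin θ • ContinuousLinearMap.fst ℝ _ _ + Real.cos θ • ContinuousLinearMap.snd ℝ _ _)
  have hWZ : HasGaussianLaw (fun ω => (Real.cos θ * X ω i - Real.sin θ * Y ω i,
      fun k => Real.sin θ * X ω k + Real.cos θ * Y ω k)) P := hXY.map_fun T
  have hsub : (fun ω => Real.cos θ * X ω i - Real.sin θ * Y ω i)
      = fun ω => Real.cos θ * X ω i + -Real.sin θ * Y ω i := by ext ω; ring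
  -- The velocity `W = cos θ X_i - sin θ Y_i` has unit variance and covariance `sin θ cos θ (r_ij -
  -- δ_ij)` with the `j`-th coordinate of the path. It vanishes at `j = i` because `r_ii = 1`.
  rw [integral_mul_prod_eq_sum hWZ
    (c := fun j => Real.sin θ * Real.cos θ * (r i j - if i = j then 1 else 0))
    (by rw [hsub]; exact hmean _ _ i)
    (by rw [hsub, hvar, neg_sq, Real.cos_sq_add_sin_sq])
    (fun j => by rw [hsub, hcov]; ring) (by simp [hr]) hd hf'c hf0 hf1 hC]
  refine (abs_sum_le_sum_abs _ _).trans (sum_le_sum fun j hj => ?_)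
  have hij : i ≠ j := (ne_of_mem_erase hj).symm
  rw [abs_mul, if_neg hij, sub_zero, abs_mul]
  have hsc : |Real.sin θ * Real.cos θ| ≤ 1 := by
    rw [abs_mul]
    exact mul_le_one₀ (Real.abs_sin_le_one θ) (abs_nonneg _) (Real.abs_cos_le_one θ)
  have hZZ : HasGaussianLaw (fun ω => (Real.sin θ * X ω i + Real.cos θ * Y ω i,
      Real.sin θ * X ω j + Real.cos θ * Y ω j)) P := hWZ.snd.prodMk i j
  have hsle : |Real.sin θ ^ 2 * r i j| ≤ |r i j| := by
    rw [abs_mul, abs_of_nonneg (sq_nonneg (Real.sin θ))]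
    exact mul_le_of_le_one_left (abs_nonneg _) (Real.sin_sq_le_one θ)
  have hB := lintegral_mul_le_of_hasGaussianLaw (s := Real.sin θ ^ 2 * r i j) hZZ (hmean _ _ i)
    (hmean _ _ j) (by rw [hvar, Real.sin_sq_add_cos_sq]) (by rw [hvar, Real.sin_sq_add_cos_sq])
    (by rw [hcov, if_neg hij]; ring) ((hsle.trans (hrρ i j hij)).trans_lt hρ) (hu i) (hu j)
    (p := fun x => ENNReal.ofReal |f' i x|) (q := fun x => ENNReal.ofReal |f' j x|)
    (ENNReal.measurable_ofReal.comp (hf'c i).abs.measurable)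
    (ENNReal.measurable_ofReal.comp (hf'c j).abs.measurable)
    (fun x hx => by simp [hfu i x hx]) (fun x hx => by simp [hfu j x hx]) (hfi i) (hfi j)
  have hI : |∫ ω, f' i (Real.sin θ * X ω i + Real.cos θ * Y ω i) *
      f' j (Real.sin θ * X ω j + Real.cos θ * Y ω j) *
        ∏ k ∈ (univ.erase i).erase j, f k (Real.sin θ * X ω k + Real.cos θ * Y ω k) ∂P| ≤
      (√(1 - ρ ^ 2))⁻¹ * Real.exp (-(u i ^ 2 + u j ^ 2) / (2 * (1 + |r i j|))) := by
    refine le_trans ?_ (inv_sqrt_mul_exp_mono hsle (hrρ i j hij) hρ)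
    rw [← Real.norm_eq_abs]
    refine (norm_integral_le_lintegral_norm _).trans
      (ENNReal.toReal_le_of_le_ofReal (by positivity) (le_trans (lintegral_mono fun ω => ?_) hB))
    rw [← ENNReal.ofReal_mul (abs_nonneg _)]
    refine ENNReal.ofReal_le_ofReal ?_
    rw [Real.norm_eq_abs, abs_mul, abs_mul]
    refine mul_le_of_le_one_right (by positivity) ?_
    rw [abs_of_nonneg (prod_nonneg fun k _ => hf0 k _)]
    exact prod_le_one (fun k _ => hf0 k _) fun k _ => hf1 k _
  calc _ ≤ 1 * |r i j| * ((√(1 - ρ ^ 2))⁻¹ *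
        Real.exp (-(u i ^ 2 + u j ^ 2) / (2 * (1 + |r i j|)))) := by gcongr
    _ = S i j := by rw [one_mul]

theorem tendsto_integral_prod_smoothStep {Ω ι : Type*} [MeasurableSpace Ω] [Fintype ι]
    {P : Measure Ω} [IsProbabilityMeasure P] {X : Ω → ι → ℝ} (hX : Measurable X) (u : ι → ℝ) :
    Tendsto (fun n : ℕ => ∫ ω, ∏ k, smoothStep (1 / ((n : ℝ) + 1)) (u k) (X ω k) ∂P) atTop
      (𝓝 (P.real {ω | ∀ k, X ω k ≤ u k})) := by
  have hms : MeasurableSet {ω | ∀ k, X ω k ≤ u k} := by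
    rw [Set.ofPred_forall]
    exact MeasurableSet.iInter fun k =>
      measurableSet_le ((measurable_pi_apply k).comp hX) measurable_const
  rw [← integral_indicator_one hms]
  refine tendsto_integral_of_dominated_convergence (fun _ => 1) (fun n => ?_)
    (integrable_const _) (fun n => ae_of_all _ fun ω => ?_) (ae_of_all _ fun ω => ?_)
  · refine (Finset.measurable_fun_prod _ fun k _ => ?_).aestronglyMeasurable
    have hc : Continuous (smoothStep (1 / ((n : ℝ) + 1)) (u k)) :=
      continuous_iff_continuousAt.2 fun x => (hasDerivAt_smoothStep _ _ x).continuousAt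
    exact hc.measurable.comp ((measurable_pi_apply k).comp hX)
  · rw [Real.norm_eq_abs, abs_of_nonneg (Finset.prod_nonneg fun k _ => smoothStep_nonneg _ _ _)]
    exact Finset.prod_le_one (fun k _ => smoothStep_nonneg _ _ _)
      fun k _ => smoothStep_le_one _ _ _
  · have h := tendsto_finsetProd (Finset.univ : Finset ι)
      fun k _ => tendsto_smoothStep (u k) (X ω k)
    convert h using 2
    by_cases hω : ∀ k, X ω k ≤ u k
    · rw [Set.indicator_of_mem (by exact hω)]
      refine (Finset.prod_eq_one fun k _ => ?_).symm
      rw [Set.indicator_of_mem (by exact hω k)]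
      rfl
    · rw [Set.indicator_of_notMem (by exact hω)]
      push Not at hω
      obtain ⟨k, hk⟩ := hω
      refine (Finset.prod_eq_zero (Finset.mem_univ k) ?_).symm
      exact Set.indicator_of_notMem (by simpa using hk) _

theorem isGaussian_pi_gaussianReal (ι : Type*) [Fintype ι] :
    IsGaussian (Measure.pi fun _ : ι => gaussianReal 0 1) := by
  have hind := iIndepFun_pi (μ := fun _ : ι => gaussianReal 0 1) (X := fun _ => id)
    fun _ => aemeasurable_id
  have h := (hind.hasGaussianLaw fun i => ?_).isGaussian_map
  · simpa using h
  · constructor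
    have := (measurePreserving_eval (fun _ : ι => gaussianReal 0 1) i).map_eq
    simp only [id]
    rw [show (fun ω : ι → ℝ => ω i) = Function.eval i from rfl, this]
    infer_instance

theorem covariance_eval_pi_gaussianReal {ι : Type*} [Fintype ι] [DecidableEq ι] (i j : ι) :
    cov[fun ω : ι → ℝ => ω i, fun ω => ω j; Measure.pi fun _ : ι => gaussianReal 0 1]
      = if i = j then 1 else 0 := by
  have hmem : ∀ i, MemLp (fun ω : ι → ℝ => ω i) 2 (Measure.pi fun _ : ι => gaussianReal 0 1) :=
    fun i => (memLp_id_gaussianReal' 2 (by simp)).comp_measurePreserving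
      (measurePreserving_eval (fun _ : ι => gaussianReal 0 1) i)
  split_ifs with h
  · subst h
    rw [covariance_self (measurable_pi_apply i).aemeasurable]
    have := variance_map (X := fun x : ℝ => x)
      (μ := Measure.pi fun _ : ι => gaussianReal 0 1) (Y := Function.eval i)
      measurable_id.aemeasurable (measurable_pi_apply i).aemeasurable
    rw [(measurePreserving_eval (fun _ : ι => gaussianReal 0 1) i).map_eq,
      variance_fun_id_gaussianReal] at this
    exact this.symm
  · have hind := iIndepFun_pi (μ := fun _ : ι => gaussianReal 0 1) (X := fun _ => id)
      fun _ => aemeasurable_id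
    exact (hind.indepFun h).covariance_eq_zero (hmem i) (hmem j)

/-- The normal comparison inequality for a Gaussian measure with standard marginals. -/
theorem abs_measureReal_sub_prod_le {ι : Type*} [Fintype ι] [DecidableEq ι]
    {μ : Measure (ι → ℝ)} [IsGaussian μ] {r : ι → ι → ℝ} {ρ : ℝ} {u : ι → ℝ}
    (h0 : ∀ i, ∫ x, x i ∂μ = 0)
    (hcov : ∀ i j, cov[fun x => x i, fun x => x j; μ] = r i j) (hr : ∀ i, r i i = 1)
    (hρ : ρ < 1) (hrρ : ∀ i j, i ≠ j → |r i j| ≤ ρ) (hu : ∀ i, 0 ≤ u i) :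
    |μ.real {x | ∀ i, x i ≤ u i} - ∏ i, (gaussianReal 0 1).real (Set.Iic (u i))| ≤
      (∑ i, ∑ j ∈ Finset.univ.erase i, |r i j| * ((√(1 - ρ ^ 2))⁻¹ *
        Real.exp (-(u i ^ 2 + u j ^ 2) / (2 * (1 + |r i j|))))) * (Real.pi / 2) := by
  set ν : Measure (ι → ℝ) := Measure.pi fun _ => gaussianReal 0 1 with hν
  have hνG : IsGaussian ν := isGaussian_pi_gaussianReal ι
  have hfst : (μ.prod ν).map Prod.fst = μ := by simp
  have hsnd : (μ.prod ν).map Prod.snd = ν := by simp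
  have hproj : ∀ (m : Measure (ι → ℝ)) (i : ι), AEStronglyMeasurable (fun x : ι → ℝ => x i) m :=
    fun m i => (measurable_pi_apply i).aestronglyMeasurable
  have hG : HasGaussianLaw (fun z : (ι → ℝ) × (ι → ℝ) => (z.1, z.2)) (μ.prod ν) :=
    IsGaussian.hasGaussianLaw_id
  have e1 : (μ.prod ν).real {z | ∀ i, z.1 i ≤ u i} = μ.real {x | ∀ i, x i ≤ u i} := by
    conv_rhs => rw [← hfst]
    rw [map_measureReal_apply measurable_fst]
    · rfl
    · rw [Set.ofPred_forall]
      exact MeasurableSet.iInter fun k => measurableSet_le (measurable_pi_apply k) measurable_const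
  have e2 : (μ.prod ν).real {z | ∀ i, z.2 i ≤ u i}
      = ∏ i, (gaussianReal 0 1).real (Set.Iic (u i)) := by
    have : ν.real (Set.univ.pi fun i => Set.Iic (u i))
        = ∏ i, (gaussianReal 0 1).real (Set.Iic (u i)) := by
      rw [hν, measureReal_def, Measure.pi_pi, ENNReal.toReal_prod]
      rfl
    rw [← this, ← hsnd, map_measureReal_apply measurable_snd
      (MeasurableSet.univ_pi fun i => measurableSet_Iic), hsnd]
    congr 1
    ext z
    simp [Pi.le_def]
  rw [← e1, ← e2]
  have l1 := tendsto_integral_prod_smoothStep (P := μ.prod ν) measurable_fst u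
  have l2 := tendsto_integral_prod_smoothStep (P := μ.prod ν) measurable_snd u
  -- The bound does not depend on the width of the step: only the total mass of the derivative
  -- enters, not its size `C`.
  refine le_of_tendsto (l1.sub l2).abs (Eventually.of_forall fun n => ?_)
  obtain ⟨C, hC⟩ := exists_abs_smoothStepDeriv_le (1 / ((n : ℝ) + 1))
  have hε : 0 < 1 / ((n : ℝ) + 1) := by positivity
  refine abs_integral_prod_sub_le hG (fun i => ?_) (fun i => ?_) (fun i j => ?_) hr
    (fun i j => ?_) (fun i j => ?_) hρ hrρ hu (fun k x => hasDerivAt_smoothStep _ _ x)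
    (fun k => continuous_smoothStepDeriv _ _) (fun k x => smoothStep_nonneg _ _ x)
    (fun k x => smoothStep_le_one _ _ x) (fun k x => hC _ x)
    (fun k x hx => smoothStepDeriv_of_lt hε hx)
    fun k => (lintegral_abs_smoothStepDeriv hε (u k)).le
  · have := integral_map (μ := μ.prod ν) measurable_fst.aemeasurable (hproj _ i)
    rw [hfst, h0] at this
    exact this.symm
  · have := integral_map (μ := μ.prod ν) measurable_snd.aemeasurable (hproj _ i)
    have h3 := integral_map (μ := ν) (φ := Function.eval i)
      (measurable_pi_apply i).aemeasurable (f := fun x : ℝ => x)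
      measurable_id.aestronglyMeasurable
    rw [(measurePreserving_eval (fun _ : ι => gaussianReal 0 1) i).map_eq,
      integral_id_gaussianReal] at h3
    rw [hsnd] at this
    exact this.symm.trans h3.symm
  · have := covariance_map_fun (μ := μ.prod ν) (hproj _ i) (hproj _ j)
      measurable_fst.aemeasurable
    rw [hfst, hcov] at this
    exact this.symm
  · have := covariance_map_fun (μ := μ.prod ν) (hproj _ i) (hproj _ j)
      measurable_snd.aemeasurable
    rw [hsnd, covariance_eval_pi_gaussianReal] at this
    exact this.symm
  · exact covariance_fst_snd_prod (X := fun x : ι → ℝ => x i) (Y := fun x : ι → ℝ => x j)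
      ((IsGaussian.hasGaussianLaw_id (μ := μ)).eval i).memLp_two
      ((IsGaussian.hasGaussianLaw_id (μ := ν)).eval j).memLp_two

theorem measureReal_comp_le_eq {Ω : Type*} [MeasurableSpace Ω] {P : Measure Ω} {Y : Ω → ℝ}
    (hY : HasGaussianLaw Y P) (hVar : 0 < Var[Y; P]) (t : ℝ) :
    P.real {ω | Y ω ≤ t} = (gaussianReal 0 1).real (Set.Iic (stdThreshold Y P t)) := by
  have hs : 0 < √(Var[Y; P]) := Real.sqrt_pos.2 hVar
  have h1 : P.real {ω | Y ω ≤ t} = (P.map Y).real (Set.Iic t) := by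
    rw [measureReal_def, measureReal_def, Measure.map_apply_of_aemeasurable hY.aemeasurable
      measurableSet_Iic]
    rfl
  have h2 : P.map Y = (gaussianReal 0 1).map (fun x => ∫ ω, Y ω ∂P + √(Var[Y; P]) * x) := by
    rw [hY.map_eq_gaussianReal]
    have : (fun x : ℝ => ∫ ω, Y ω ∂P + √(Var[Y; P]) * x) =
      (fun x => ∫ ω, Y ω ∂P + x) ∘ fun x => √(Var[Y; P]) * x := rfl
    rw [this, ← Measure.map_map (by fun_prop) (by fun_prop), gaussianReal_map_const_mul,
      gaussianReal_map_const_add]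
    congr 1
    · simp
    · ext
      simp [Real.sq_sqrt hVar.le, Real.coe_toNNReal _ hVar.le]
  rw [h1, h2, map_measureReal_apply (by fun_prop) measurableSet_Iic]
  congr 1
  ext x
  simp only [Set.mem_preimage, Set.mem_Iic, stdThreshold]
  rw [le_div_iff₀ hs, le_sub_iff_add_le', mul_comm]

/-- The normal comparison inequality for the maximum of a Gaussian vector. -/
theorem abs_measureReal_iSup_le_sub_prod_le {Ω : Type*} [MeasurableSpace Ω] {P : Measure Ω}
    [IsProbabilityMeasure P] {d : ℕ} (hd : 0 < d) {X : Ω → Fin d → ℝ} (hX : HasGaussianLaw X P)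
    (hVar : ∀ i, 0 < Var[comp X i; P]) {ρ t : ℝ} (hρ : ρ < 1)
    (hrρ : ∀ i j, i ≠ j → |corr (comp X i) (comp X j) P| ≤ ρ)
    (hu : ∀ i, 0 ≤ stdThreshold (comp X i) P t) :
    |P.real {ω | (⨆ i, X ω i) ≤ t} - ∏ i, P.real {ω | X ω i ≤ t}| ≤
      (∑ i, ∑ j ∈ Finset.univ.erase i, |corr (comp X i) (comp X j) P| * ((√(1 - ρ ^ 2))⁻¹ *
        Real.exp (-(stdThreshold (comp X i) P t ^ 2 + stdThreshold (comp X j) P t ^ 2) /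
          (2 * (1 + |corr (comp X i) (comp X j) P|))))) * (Real.pi / 2) := by
  -- Over an empty index set the real supremum would take the default value `0`.
  have : Nonempty (Fin d) := ⟨⟨0, hd⟩⟩
  have hXg : ∀ i, HasGaussianLaw (comp X i) P := fun i => hX.eval i
  have hs : ∀ i, 0 < √(Var[comp X i; P]) := fun i => Real.sqrt_pos.2 (hVar i)
  set S : Ω → Fin d → ℝ := fun ω i => (comp X i ω - ∫ ω, comp X i ω ∂P) / √(Var[comp X i; P])
    with hS
  have hSi : ∀ i, (fun ω => S ω i)
      = fun ω => (comp X i ω - ∫ ω, comp X i ω ∂P) / √(Var[comp X i; P]) := fun i => rfl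
  let T : (Fin d → ℝ) →L[ℝ] (Fin d → ℝ) := ContinuousLinearMap.pi fun i =>
    (√(Var[comp X i; P]))⁻¹ • ContinuousLinearMap.proj (R := ℝ) (φ := fun _ : Fin d => ℝ) i
  let c : Fin d → ℝ := fun i => (∫ ω, comp X i ω ∂P) / √(Var[comp X i; P])
  have hST : S = (fun x => x - c) ∘ fun ω => T (X ω) := by
    ext ω i
    simp only [hS, comp, T, c, Function.comp_apply, Pi.sub_apply, ContinuousLinearMap.pi_apply,
      smul_apply, ContinuousLinearMap.proj_apply, smul_eq_mul]
    ring
  have hTX : HasGaussianLaw (fun ω => T (X ω)) P := hX.map_fun T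
  have hμ : IsGaussian (P.map S) := by
    have := hTX.isGaussian_map
    rw [hST, ← AEMeasurable.map_map_of_aemeasurable (by fun_prop) hTX.aemeasurable]
    infer_instance
  have hSm : AEMeasurable S P := by
    rw [hST]
    exact (measurable_id.sub_const c).comp_aemeasurable hTX.aemeasurable
  have hproj : ∀ (m : Measure (Fin d → ℝ)) (i), AEStronglyMeasurable (fun x : Fin d → ℝ => x i) m :=
    fun m i => (measurable_pi_apply i).aestronglyMeasurable
  have hcov : ∀ i j, cov[fun x => x i, fun x => x j; P.map S] = corr (comp X i) (comp X j) P := by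
    intro i j
    rw [covariance_map_fun (hproj _ i) (hproj _ j) hSm, hSi, hSi, covariance_fun_div_left,
      covariance_fun_div_right]
    have hj : Integrable (fun ω => comp X j ω) P := (hXg j).integrable
    have hi : Integrable (fun ω => comp X i ω) P := (hXg i).integrable
    rw [covariance_sub_const_left hi, covariance_sub_const_right hj, div_div, corr,
      Real.sqrt_mul (hVar i).le, mul_comm]
  have key := abs_measureReal_sub_prod_le (μ := P.map S) (u := fun i => stdThreshold (comp X i) P t)
    (fun i => ?_) hcov (fun i => ?_) hρ hrρ hu
  · have e1 : (P.map S).real {x | ∀ i, x i ≤ stdThreshold (comp X i) P t}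
        = P.real {ω | (⨆ i, X ω i) ≤ t} := by
      have hms : MeasurableSet {x : Fin d → ℝ | ∀ i, x i ≤ stdThreshold (comp X i) P t} := by
        rw [Set.ofPred_forall]
        exact MeasurableSet.iInter fun k =>
          measurableSet_le (measurable_pi_apply k) measurable_const
      rw [measureReal_def, measureReal_def, Measure.map_apply_of_aemeasurable hSm hms]
      congr 2
      ext ω
      simp only [Set.mem_preimage, Set.mem_ofPred_eq]
      rw [ciSup_le_iff (Set.finite_range _).bddAbove]
      refine forall_congr' fun i => ?_
      simp only [hS, stdThreshold, comp]
      rw [div_le_div_iff_of_pos_right (hs i), sub_le_sub_iff_right]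
    have e2 : ∀ i, (gaussianReal 0 1).real (Set.Iic (stdThreshold (comp X i) P t))
        = P.real {ω | X ω i ≤ t} := fun i => (measureReal_comp_le_eq (hXg i) (hVar i) t).symm
    simp_rw [e1, e2] at key
    exact key
  · rw [integral_map hSm (hproj _ i), hSi, integral_div,
      integral_sub (hXg i).integrable (integrable_const _)]
    simp
  · rw [corr, covariance_self (hXg i).aemeasurable, Real.sqrt_mul_self (hVar i).le,
      div_self (hVar i).ne']

/-! ### Gaussian tails and the weakly dependent pairs. -/

/-- A lower bound of Mills ratio type for the Gaussian tail. -/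
theorem exp_neg_sq_div_two_le_gaussianReal_Ioi {u : ℝ} (hu : 1 ≤ u) :
    Real.exp (-u ^ 2 / 2) ≤
      √(2 * Real.pi) * Real.exp (3 / 2) * u * (gaussianReal 0 1).real (Set.Ioi u) := by
  have hu0 : 0 < u := by linarith
  have h2pi : 0 < √(2 * Real.pi) := Real.sqrt_pos.2 (by positivity)
  set m := (√(2 * Real.pi))⁻¹ * Real.exp (-u ^ 2 / 2 - 3 / 2) with hm
  -- On an interval of length `1 / u` the density loses at most a factor `exp (-3 / 2)`, since `(u +
  -- 1 / u)² ≤ u² + 3` for `u ≥ 1`.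
  have hle : ∀ x ∈ Set.Ioc u (u + 1 / u), m ≤ gaussianPDFReal 0 1 x := by
    intro x hx
    simp only [gaussianPDFReal_def, NNReal.coe_one, mul_one, sub_zero, hm]
    gcongr
    have h1 : x ^ 2 ≤ (u + 1 / u) ^ 2 := by
      have := hx.1
      have := hx.2
      gcongr
      linarith
    have h2 : (u + 1 / u) ^ 2 = u ^ 2 + 2 + (1 / u) ^ 2 := by field_simp; ring
    have h3 : 1 / u ≤ 1 := (div_le_one hu0).2 hu
    have h4 : (1 / u) ^ 2 ≤ 1 := pow_le_one₀ (by positivity) h3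
    linarith
  have hint : m * (1 / u) ≤ (gaussianReal 0 1).real (Set.Ioi u) := by
    have h1 : (gaussianReal 0 1).real (Set.Ioc u (u + 1 / u)) ≤
        (gaussianReal 0 1).real (Set.Ioi u) := measureReal_mono Set.Ioc_subset_Ioi_self
    refine le_trans ?_ h1
    have h2 : ENNReal.ofReal (m * (1 / u)) ≤ gaussianReal 0 1 (Set.Ioc u (u + 1 / u)) := by
      rw [gaussianReal_apply _ one_ne_zero]
      calc ENNReal.ofReal (m * (1 / u)) = ∫⁻ _ in Set.Ioc u (u + 1 / u), ENNReal.ofReal m := by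
            rw [setLIntegral_const, Real.volume_Ioc, ← ENNReal.ofReal_mul (by positivity)]
            congr 2
            ring
        _ ≤ _ := setLIntegral_mono (measurable_gaussianPDF 0 1)
            fun x hx => ENNReal.ofReal_le_ofReal (hle x hx)
    exact (ENNReal.ofReal_le_iff_le_toReal (measure_ne_top _ _)).1 h2
  calc Real.exp (-u ^ 2 / 2)
      = √(2 * Real.pi) * Real.exp (3 / 2) * u * (m * (1 / u)) := by
        rw [hm, Real.exp_sub]
        field_simp
    _ ≤ _ := by gcongr

/-- By `log x ≤ x - 1` at each factor. A positive lower bound on the product thus bounds the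
expected number of exceedances. -/
theorem sum_gaussianReal_Ioi_le_neg_log_prod {ι : Type*} [Fintype ι] {u : ι → ℝ}
    (h : 0 < ∏ i, (gaussianReal 0 1).real (Set.Iic (u i))) :
    ∑ i, (gaussianReal 0 1).real (Set.Ioi (u i)) ≤
      -Real.log (∏ i, (gaussianReal 0 1).real (Set.Iic (u i))) := by
  have hne : ∀ i, (gaussianReal 0 1).real (Set.Iic (u i)) ≠ 0 := fun i hi =>
    h.ne' (Finset.prod_eq_zero (Finset.mem_univ i) hi)
  rw [Real.log_prod fun i _ => hne i, ← Finset.sum_neg_distrib]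
  refine Finset.sum_le_sum fun i _ => ?_
  have hpos : 0 < (gaussianReal 0 1).real (Set.Iic (u i)) :=
    lt_of_le_of_ne measureReal_nonneg (hne i).symm
  have h1 := Real.log_le_sub_one_of_pos hpos
  have h2 := probReal_compl_eq_one_sub (μ := gaussianReal 0 1) (measurableSet_Iic (a := u i))
  rw [Set.compl_Iic] at h2
  linarith

/-- A bound for one tail factor, according to whether the level is below or above `√(8 log d)`. -/
theorem exp_neg_sq_div_le {u r L : ℝ} (hu : 1 ≤ u) (hr0 : 0 ≤ r) (hr1 : r ≤ 1) (hrL : r * L ≤ 1)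
    (hL : 0 ≤ L) :
    Real.exp (-u ^ 2 / (2 * (1 + r))) ≤
      Real.exp 4 * (√(2 * Real.pi) * Real.exp (3 / 2) * √(8 * L) *
        (gaussianReal 0 1).real (Set.Ioi u)) + Real.exp (-L) := by
  have hq : 0 ≤ (gaussianReal 0 1).real (Set.Ioi u) := measureReal_nonneg
  -- For `u² ≤ 8L`, replacing `1 + r` by `1` costs at most `r u² / 2 ≤ 4` in the exponent, and Mills
  -- ratio applies with `u ≤ √(8L)`. For `u² > 8L`, `1 + r ≤ 2` already gives an exponent below
  -- `-L`.
  rcases le_or_gt (u ^ 2) (8 * L) with h | h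
  · have h1 : -u ^ 2 / (2 * (1 + r)) ≤ 4 + -u ^ 2 / 2 := by
      have e : -u ^ 2 / (2 * (1 + r)) = -u ^ 2 / 2 + r * u ^ 2 / (2 * (1 + r)) := by
        field_simp
        ring
      have h3 : r * u ^ 2 / (2 * (1 + r)) ≤ 4 := by
        rw [div_le_iff₀ (by positivity)]
        nlinarith
      linarith
    have h2 : u ≤ √(8 * L) := Real.le_sqrt_of_sq_le h
    have h3 : Real.exp (-u ^ 2 / (2 * (1 + r))) ≤
        Real.exp 4 * (√(2 * Real.pi) * Real.exp (3 / 2) * √(8 * L) *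
        (gaussianReal 0 1).real (Set.Ioi u)) :=
      calc _ ≤ Real.exp (4 + -u ^ 2 / 2) := Real.exp_le_exp.2 h1
        _ = Real.exp 4 * Real.exp (-u ^ 2 / 2) := Real.exp_add _ _
        _ ≤ Real.exp 4 * (√(2 * Real.pi) * Real.exp (3 / 2) * u *
            (gaussianReal 0 1).real (Set.Ioi u)) := by
          gcongr
          exact exp_neg_sq_div_two_le_gaussianReal_Ioi hu
        _ ≤ _ := by gcongr
    linarith [Real.exp_pos (-L)]
  · have h1 : -u ^ 2 / (2 * (1 + r)) ≤ -L := by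
      rw [div_le_iff₀ (by positivity)]
      nlinarith
    have h2 := Real.exp_le_exp.2 h1
    have : 0 ≤ Real.exp 4 * (√(2 * Real.pi) * Real.exp (3 / 2) * √(8 * L) *
        (gaussianReal 0 1).real (Set.Ioi u)) := by positivity
    linarith

/-- The total contribution of the weakly dependent pairs. -/
theorem mul_sq_sum_exp_neg_sq_le {d : ℕ} (hd : 2 ≤ d) {u : Fin d → ℝ} {r A : ℝ}
    (hu : ∀ i, 1 ≤ u i) (hr0 : 0 ≤ r) (hr1 : r ≤ 1) (hrL : r * Real.log d ≤ 1)
    (hA : ∑ i, (gaussianReal 0 1).real (Set.Ioi (u i)) ≤ A) :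
    r * (∑ i, Real.exp (-u i ^ 2 / (2 * (1 + r)))) ^ 2 ≤
      (16 * (Real.exp 4 * (√(2 * Real.pi) * Real.exp (3 / 2)) * A) ^ 2 + 4) *
        (r * Real.log d) := by
  set L := Real.log d with hLdef
  set B := Real.exp 4 * (√(2 * Real.pi) * Real.exp (3 / 2)) with hB
  have hd0 : (0 : ℝ) < d := by positivity
  have hL : 1 / 2 ≤ L := by
    have h1 : Real.log 2 ≤ L := Real.log_le_log (by norm_num) (by exact_mod_cast hd)
    linarith [Real.log_two_gt_d9]
  have hA0 : 0 ≤ A := le_trans (Finset.sum_nonneg fun i _ => measureReal_nonneg) hA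
  -- With `L = log d`, the `d` terms `exp (-L)` add up to `1`.
  have hsum : ∑ i, Real.exp (-u i ^ 2 / (2 * (1 + r))) ≤ B * A * √(8 * L) + 1 :=
    calc _ ≤ ∑ i, (B * √(8 * L) * (gaussianReal 0 1).real (Set.Ioi (u i)) + Real.exp (-L)) := by
          refine Finset.sum_le_sum fun i _ => ?_
          refine (exp_neg_sq_div_le (hu i) hr0 hr1 hrL (by linarith)).trans_eq ?_
          rw [hB]
          ring
      _ = B * √(8 * L) * ∑ i, (gaussianReal 0 1).real (Set.Ioi (u i)) + 1 := by
          rw [Finset.sum_add_distrib, ← Finset.mul_sum, Finset.sum_const, Finset.card_univ,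
            Fintype.card_fin, nsmul_eq_mul, hLdef, Real.exp_neg, Real.exp_log hd0,
            mul_inv_cancel₀ hd0.ne']
      _ ≤ B * √(8 * L) * A + 1 := by gcongr
      _ = _ := by ring
  -- Uses `(x + 1)² ≤ 2x² + 2`; the constant `2` is absorbed into `4L` because `L ≥ 1 / 2`.
  have hsq : (∑ i, Real.exp (-u i ^ 2 / (2 * (1 + r)))) ^ 2 ≤ (16 * (B * A) ^ 2 + 4) * L := by
    have h0 : 0 ≤ ∑ i, Real.exp (-u i ^ 2 / (2 * (1 + r))) :=
      Finset.sum_nonneg fun i _ => (Real.exp_pos _).le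
    have h8 : √(8 * L) ^ 2 = 8 * L := Real.sq_sqrt (by linarith)
    calc _ ≤ (B * A * √(8 * L) + 1) ^ 2 := by gcongr
      _ ≤ 2 * ((B * A) ^ 2 * √(8 * L) ^ 2) + 2 := by
          nlinarith [sq_nonneg (B * A * √(8 * L) - 1)]
      _ ≤ _ := by rw [h8]; nlinarith
  calc _ ≤ r * ((16 * (B * A) ^ 2 + 4) * L) := by gcongr
    _ = _ := by ring

/-! ### Splitting the pairs and passing to the limit. -/

theorem sum_sum_erase_eq_two_mul {d : ℕ} {g : Fin d → Fin d → ℝ} (hg : ∀ i j, g i j = g j i) :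
    ∑ i, ∑ j ∈ Finset.univ.erase i, g i j
      = 2 * ∑ i, ∑ j ∈ Finset.univ.filter (· < i), g i j := by
  have h1 : ∀ i, ∑ j ∈ Finset.univ.erase i, g i j = ∑ j ∈ Finset.univ.filter (· < i), g i j +
      ∑ j ∈ Finset.univ.filter (i < ·), g i j := by
    intro i
    rw [← Finset.sum_union (Finset.disjoint_filter.2 fun j _ h1 h2 => lt_asymm h1 h2)]
    congr 1
    ext j
    simp [lt_or_lt_iff_ne]
  simp_rw [h1]
  rw [Finset.sum_add_distrib, two_mul]
  congr 1
  simp_rw [Finset.sum_filter]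
  rw [Finset.sum_comm]
  simp_rw [hg]

theorem corr_comm {Ω : Type*} [MeasurableSpace Ω] (Y Z : Ω → ℝ) (P : Measure Ω) :
    corr Y Z P = corr Z Y P := by
  rw [corr, corr, covariance_comm, mul_comm]

theorem maxWeakCorr_nonneg {Ω : Type*} [MeasurableSpace Ω] {d : ℕ} (X : Ω → Fin d → ℝ)
    (P : Measure Ω) (D : Digraph (Fin d)) : 0 ≤ maxWeakCorr X P D :=
  Real.iSup_nonneg fun _ => abs_nonneg _

theorem abs_corr_le_maxWeakCorr {Ω : Type*} [MeasurableSpace Ω] {d : ℕ} (X : Ω → Fin d → ℝ)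
    (P : Measure Ω) (D : Digraph (Fin d)) {i j : Fin d} (hji : j < i) (hj : j ∉ closedNhd D i) :
    |corr (comp X i) (comp X j) P| ≤ maxWeakCorr X P D :=
  le_ciSup (f := fun p : weakPairs D => |corr (comp X p.1.1) (comp X p.1.2) P|)
    (Set.finite_range _).bddAbove ⟨(i, j), hji, hj⟩

open Classical in
/-- The sum over all pairs splits into strongly and weakly dependent pairs. -/
theorem sum_sum_lt_le_strongSum_add {Ω : Type*} [MeasurableSpace Ω] {d : ℕ} (X : Ω → Fin d → ℝ)
    (P : Measure Ω) (D : Digraph (Fin d)) (t : ℝ)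
    (h1 : ∀ i j, i ≠ j → |corr (comp X i) (comp X j) P| ≤ 1) :
    ∑ i, ∑ j ∈ Finset.univ.filter (· < i), |corr (comp X i) (comp X j) P| *
        Real.exp (-(stdThreshold (comp X i) P t ^ 2 + stdThreshold (comp X j) P t ^ 2) /
          (2 * (1 + |corr (comp X i) (comp X j) P|))) ≤
      strongSum X P t D + maxWeakCorr X P D *
        (∑ i, Real.exp (-stdThreshold (comp X i) P t ^ 2 / (2 * (1 + maxWeakCorr X P D)))) ^ 2 := by
  set r := maxWeakCorr X P D with hr
  have hr0 : 0 ≤ r := maxWeakCorr_nonneg X P D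
  set u : Fin d → ℝ := fun i => stdThreshold (comp X i) P t with hu
  set g : Fin d → ℝ := fun i => Real.exp (-u i ^ 2 / (2 * (1 + r))) with hg
  -- With the common `r` the exponential of a pair is the product `g i * g j`. The square runs over
  -- all pairs; the surplus terms are nonnegative.
  have hsq : r * (∑ i, g i) ^ 2 = ∑ i, ∑ j, r * (g i * g j) := by
    rw [sq, Finset.sum_mul_sum, Finset.mul_sum]
    simp_rw [Finset.mul_sum]
  rw [hsq, strongSum, ← Finset.sum_add_distrib]
  refine Finset.sum_le_sum fun i _ => ?_
  rw [← Finset.sum_filter_add_sum_filter_not (Finset.univ.filter (· < i))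
    (fun j => j ∈ closedNhd D i)]
  have hs : (Finset.univ.filter (· < i)).filter (fun j => j ∈ closedNhd D i) = strongPred D i := by
    rw [strongPred, Finset.filter_filter]
  rw [hs]
  refine add_le_add (Finset.sum_le_sum fun j hj => ?_) ?_
  · have hji : j < i := (Finset.mem_filter.1 hj).2.1
    exact mul_le_of_le_one_left (Real.exp_pos _).le (h1 i j hji.ne')
  · refine le_trans (Finset.sum_le_sum fun j hj => ?_)
      (Finset.sum_le_sum_of_subset_of_nonneg (Finset.subset_univ _)
        fun j _ _ => mul_nonneg hr0 (mul_nonneg (Real.exp_pos _).le (Real.exp_pos _).le))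
    rw [Finset.mem_filter, Finset.mem_filter] at hj
    have hc := abs_corr_le_maxWeakCorr X P D hj.1.2 hj.2
    rw [← Real.exp_add]
    gcongr
    have h5 : (u i ^ 2 + u j ^ 2) / (2 * (1 + r)) ≤
        (u i ^ 2 + u j ^ 2) / (2 * (1 + |corr (comp X i) (comp X j) P|)) := by gcongr
    rw [← add_div, ← neg_add, neg_div, neg_div]
    exact neg_le_neg h5

theorem tendsto_measureReal_iSup_sub_prod
    {Ω : ℕ → Type*} [∀ n, MeasurableSpace (Ω n)]
    (P : ∀ n, Measure (Ω n)) [∀ n, IsProbabilityMeasure (P n)]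
    (d : ℕ → ℕ) (hd : ∀ n, 0 < d n)
    (X : ∀ n, Ω n → Fin (d n) → ℝ)
    (hX : ∀ n, HasGaussianLaw (X n) (P n))
    (hVar : ∀ n i, 0 < Var[comp (X n) i; P n])
    (t : ℕ → ℝ) {F : ℝ} (hF : 0 < F)
    (hprod : Tendsto (fun n => ∏ i, (P n).real {ω | X n ω i ≤ t n}) atTop (𝓝 F))
    (D : ∀ n, Digraph (Fin (d n)))
    (hmin : 1 < liminf (fun n => uMin (X n) (P n) (t n)) atTop)
    (hweak : Tendsto (fun n => maxWeakCorr (X n) (P n) (D n) * Real.log (d n)) atTop (𝓝 0))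
    (hstrong : Tendsto (fun n => strongSum (X n) (P n) (t n) (D n)) atTop (𝓝 0))
    {ρ : ℝ} (hρ : ρ < 1)
    (hmax : limsup (fun n => maxCorr (X n) (P n)) atTop < (ρ : EReal)) :
    Tendsto (fun n => (P n).real {ω | (⨆ i, X n ω i) ≤ t n} -
      ∏ i, (P n).real {ω | X n ω i ≤ t n}) atTop (𝓝 0) := by
  set A := -Real.log (F / 2) with hA
  set K := 16 * (Real.exp 4 * (√(2 * Real.pi) * Real.exp (3 / 2)) * A) ^ 2 + 4 with hK
  set M := (√(1 - ρ ^ 2))⁻¹ with hM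
  have hM0 : 0 ≤ M := by positivity
  have hlim : Tendsto (fun n => M * (2 * (strongSum (X n) (P n) (t n) (D n) +
      K * (maxWeakCorr (X n) (P n) (D n) * Real.log (d n)))) * (Real.pi / 2)) atTop (𝓝 0) := by
    simpa using (((hstrong.add (hweak.const_mul K)).const_mul 2).const_mul M).mul_const
      (Real.pi / 2)
  refine squeeze_zero_norm' ?_ hlim
  filter_upwards [eventually_lt_of_lt_liminf hmin, eventually_lt_of_limsup_lt hmax,
    -- Together with `log d ≥ 1 / 2` for `d ≥ 2`, the threshold `1 / 2` forces `r ≤ 1`.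
    hweak.eventually (gt_mem_nhds (by norm_num : (0 : ℝ) < 1 / 2)),
    hprod.eventually (lt_mem_nhds (half_lt_self hF))] with n h1 h2 h3 h4
  have hu : ∀ i, 1 < stdThreshold (comp (X n) i) (P n) (t n) := fun i => by
    have := lt_of_lt_of_le h1 (iInf_le _ i)
    exact_mod_cast this
  have hr : ∀ i j, i ≠ j → |corr (comp (X n) i) (comp (X n) j) (P n)| ≤ ρ := fun i j hij => by
    have h5 : ((|corr (comp (X n) i) (comp (X n) j) (P n)| : ℝ) : EReal) ≤
        maxCorr (X n) (P n) := le_iSup_of_le i (le_iSup_of_le j (le_iSup_of_le hij le_rfl))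
    exact_mod_cast (h5.trans_lt h2).le
  rw [Real.norm_eq_abs]
  refine (abs_measureReal_iSup_le_sub_prod_le (hd n) (hX n) (hVar n) hρ hr
    fun i => by linarith [hu i]).trans ?_
  refine mul_le_mul_of_nonneg_right ?_ (by positivity)
  rw [← hM]
  simp_rw [mul_left_comm _ M, ← Finset.mul_sum]
  refine mul_le_mul_of_nonneg_left ?_ hM0
  rw [sum_sum_erase_eq_two_mul fun i j => by rw [corr_comm, add_comm (_ ^ 2)]]
  refine mul_le_mul_of_nonneg_left ?_ zero_le_two
  refine (sum_sum_lt_le_strongSum_add (X n) (P n) (D n) (t n)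
    fun i j hij => (hr i j hij).trans hρ.le).trans ?_
  refine add_le_add le_rfl ?_
  have hr0 := maxWeakCorr_nonneg (X n) (P n) (D n)
  -- For `d = 1` there are no pairs, and the supremum over the empty type is `0`.
  rcases Nat.lt_or_ge (d n) 2 with h5 | h5
  · have hemp : IsEmpty (weakPairs (D n)) := by
      refine ⟨fun p => ?_⟩
      have h6 := p.2.1
      have h7 := p.1.1.2
      have h8 := p.1.2.2
      rw [Fin.lt_def] at h6
      omega
    have h0 : maxWeakCorr (X n) (P n) (D n) = 0 := Real.iSup_of_isEmpty _
    rw [h0]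
    simp
  · have hL : 1 / 2 ≤ Real.log (d n) := by
      have h6 : Real.log 2 ≤ Real.log (d n) :=
        Real.log_le_log (by norm_num) (by exact_mod_cast h5)
      linarith [Real.log_two_gt_d9]
    have hr1 : maxWeakCorr (X n) (P n) (D n) ≤ 1 := by nlinarith
    refine mul_sq_sum_exp_neg_sq_le h5 (fun i => (hu i).le) hr0 hr1 (by linarith) ?_
    have e : ∏ i, (P n).real {ω | X n ω i ≤ t n}
        = ∏ i, (gaussianReal 0 1).real
          (Set.Iic (stdThreshold (comp (X n) i) (P n) (t n))) :=
      Finset.prod_congr rfl fun i _ => measureReal_comp_le_eq ((hX n).eval i) (hVar n i) (t n)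
    rw [e] at h4
    -- The product eventually exceeds `F / 2`, whence `A = -log (F / 2)`.
    refine (sum_gaussianReal_Ioi_le_neg_log_prod (lt_trans (by positivity) h4)).trans ?_
    exact neg_le_neg (Real.log_le_log (by positivity) h4.le)

end GaussExtremes

theorem mainTheorem3
    {Ω : ℕ → Type*} [∀ n, MeasurableSpace (Ω n)]
    (P : ∀ n, Measure (Ω n)) [∀ n, IsProbabilityMeasure (P n)]
    (d : ℕ → ℕ) (hd : ∀ n, 0 < d n)
    (X : ∀ n, Ω n → Fin (d n) → ℝ)
    (hX : ∀ n, HasGaussianLaw (X n) (P n))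
    (hVar : ∀ n i, 0 < Var[GaussExtremes.comp (X n) i; P n])
    (a b : ℕ → ℝ) (F : ℝ → ℝ) (hF : ∀ x, 0 < F x)
    (hprod : ∀ x, Tendsto
      (fun n => ∏ i, (P n).real {ω | X n ω i ≤ a n + b n * x}) atTop (𝓝 (F x)))
    (hG : ∀ x : ℝ, ∃ D : ∀ n, Digraph (Fin (d n)),
      1 < liminf (fun n => GaussExtremes.uMin (X n) (P n) (a n + b n * x)) atTop ∧
      Tendsto (fun n => GaussExtremes.maxWeakCorr (X n) (P n) (D n) * Real.log (d n))
        atTop (𝓝 0) ∧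
      Tendsto (fun n => GaussExtremes.strongSum (X n) (P n) (a n + b n * x) (D n))
        atTop (𝓝 0) ∧
      ∃ ρ : ℝ, 0 < ρ ∧ ρ < 1 ∧
        limsup (fun n => GaussExtremes.maxCorr (X n) (P n)) atTop < (ρ : EReal)) :
    ∀ x : ℝ, Tendsto
      (fun n => (P n).real {ω | (⨆ i, X n ω i) ≤ a n + b n * x}) atTop (𝓝 (F x)) := by
  intro x
  obtain ⟨D, hmin, hweak, hstrong, ρ, -, hρ, hmax⟩ := hG x
  have h := GaussExtremes.tendsto_measureReal_iSup_sub_prod P d hd X hX hVar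
    (fun n => a n + b n * x) (hF x) (hprod x) D hmin hweak hstrong hρ hmax
  simpa using h.add (hprod x)
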